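/- Let $0<R_1<R_2$, let $\Omega=\{x\in\mathbb R^3: R_1<|x|<R_2\}$, and let $\Gamma_i=\{x\in\mathbb R^3:|x|=R_i\}$, $i=1,2$, so that $\partial\Omega=\Gamma_1\cup\Gamma_2$, with outer unit normal $n$ ($n=x/R_2$ on $\Gamma_2$ and $n=-x/R_1$ on $\Gamma_1$). Let $v_*\in L^2(\partial\Omega;\mathbb R^3)$ (for instance $v_*\in W^{1/2,2}(\partial\Omega)$) satisfy $$\Phi:=\int_{\Gamma_2}v_*\cdot n\,d\sigma=-\int_{\Gamma_1}v_*\cdot n\,d\sigma,\qquad \Phi>0 .$$ Then the Leray--Hopf Extension Condition fails for $v_*$. That is, the following assertion is false: for every $\varepsilon>0$ there is a field $V_\varepsilon\in W^{1,2}(\Omega;\mathbb R^3)$ with $\operatorname{div}V_\varepsilon=0$ in $\Omega$ and with trace $v_*$ on $\partial\Omega$ such that $$-\int_\Omega\sum_{i,j=1}^3 u_j\,\frac{\partial (V_\varepsilon)_i}{\partial x_j}\,u_i\,dx\ \le\ \varepsilon\int_\Omega|\nabla u|^2\,dx$$ for all $u\in W^{1,2}_0(\Omega;\mathbb R^3)$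 with $\operatorname{div}u=0$ in $\Omega$. -/

import Mathlib

open MeasureTheory Filter Topology
open scoped ContDiff ENNReal

/-- Three-dimensional Euclidean space. -/
abbrev E3 : Type := EuclideanSpace ℝ (Fin 3)

/-- The open spherical shell with radii `R₁` and `R₂`, centred at the origin. -/
def shell (R₁ R₂ : ℝ) : Set E3 := {x | R₁ < ‖x‖ ∧ ‖x‖ < R₂}

/-- The surface measure of the sphere of radius `R` centred at the origin: the image, scaled by
`R ^ 2`, of the surface measure of the unit sphere (whose total mass is `4 * π`) under the
dilation `z ↦ R • z`. -/
noncomputable def sphereMeasure (R : ℝ) : Measure E3 :=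
  ENNReal.ofReal (R ^ 2) •
    (volume : Measure E3).toSphere.map (fun z : Metric.sphere (0 : E3) 1 => R • (z : E3))

/-- The surface measure of the boundary of the shell. -/
noncomputable def shellBoundaryMeasure (R₁ R₂ : ℝ) : Measure E3 :=
  sphereMeasure R₁ + sphereMeasure R₂

/-- The classical partial derivative `∂φ/∂xⱼ` of a scalar function. -/
noncomputable def partialD (j : Fin 3) (φ : E3 → ℝ) (x : E3) : ℝ :=
  fderiv ℝ φ x (EuclideanSpace.single j 1)

/-- The classical gradient of a vector field: the entry `i j` is `∂Vᵢ/∂xⱼ`. -/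
noncomputable def gradField (V : E3 → E3) (x : E3) : Matrix (Fin 3) (Fin 3) ℝ :=
  Matrix.of fun i j => partialD j (fun y => V y i) x

/-- `V` belongs to `W^{1,2}(Ω)` and `G` is its weak gradient: the entry `i j` of `G` is the weak
derivative `∂Vᵢ/∂xⱼ`. The weak gradient is unique up to null sets. -/
structure IsW12 (Ω : Set E3) (V : E3 → E3) (G : E3 → Matrix (Fin 3) (Fin 3) ℝ) : Prop where
  memLp : MemLp V 2 (volume.restrict Ω)
  memLp_grad : ∀ i j, MemLp (fun x => G x i j) 2 (volume.restrict Ω)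
  weak_grad : ∀ φ : E3 → ℝ, ContDiff ℝ ∞ φ → HasCompactSupport φ → tsupport φ ⊆ Ω →
    ∀ i j, ∫ x in Ω, V x i * partialD j φ x = - ∫ x in Ω, G x i j * φ x

/-- The smooth fields `W k`, with their classical gradients, converge in the norm of `W^{1,2}(Ω)`
to the field `V` with weak gradient `G`. -/
def TendstoW12 (Ω : Set E3) (W : ℕ → E3 → E3) (V : E3 → E3)
    (G : E3 → Matrix (Fin 3) (Fin 3) ℝ) : Prop :=
  Tendsto (fun k => eLpNorm (fun x => W k x - V x) 2 (volume.restrict Ω)) atTop (𝓝 0) ∧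
  ∀ i j, Tendsto (fun k => eLpNorm (fun x => gradField (W k) x i j - G x i j) 2
    (volume.restrict Ω)) atTop (𝓝 0)

/-- `u`, with weak gradient `H`, belongs to `W^{1,2}_0(Ω)`, the closure in `W^{1,2}(Ω)` of the
smooth fields with compact support in `Ω`. -/
def IsW120 (Ω : Set E3) (u : E3 → E3) (H : E3 → Matrix (Fin 3) (Fin 3) ℝ) : Prop :=
  IsW12 Ω u H ∧ ∃ W : ℕ → E3 → E3,
    (∀ k, ContDiff ℝ ∞ (W k) ∧ HasCompactSupport (W k) ∧ tsupport (W k) ⊆ Ω) ∧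
    TendstoW12 Ω W u H

/-- A field with weak gradient `G` is solenoidal in `Ω`: its divergence vanishes almost
everywhere in `Ω`. -/
def IsSolenoidal (Ω : Set E3) (G : E3 → Matrix (Fin 3) (Fin 3) ℝ) : Prop :=
  ∀ᵐ x ∂(volume.restrict Ω), (G x).trace = 0

/-- `v` is the trace on the boundary of `Ω` (with surface measure `σ`) of the field `V` in
`W^{1,2}(Ω)` with weak gradient `G`: fields that are smooth up to the boundary converge to `V`
in `W^{1,2}(Ω)` while their boundary values converge to `v` in `L²(∂Ω)`. -/
def HasTrace (Ω : Set E3) (σ : Measure E3) (V : E3 → E3)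
    (G : E3 → Matrix (Fin 3) (Fin 3) ℝ) (v : E3 → E3) : Prop :=
  ∃ W : ℕ → E3 → E3, (∀ k, ContDiff ℝ ∞ (W k)) ∧ TendstoW12 Ω W V G ∧
    Tendsto (fun k => eLpNorm (fun x => W k x - v x) 2 σ) atTop (𝓝 0)

/-- The integral `(u · ∇V, u) = ∫_Ω uⱼ (∂Vᵢ/∂xⱼ) uᵢ`, where `G` is the gradient of `V`. -/
noncomputable def convectionForm (Ω : Set E3) (u : E3 → E3)
    (G : E3 → Matrix (Fin 3) (Fin 3) ℝ) : ℝ :=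
  ∫ x in Ω, ∑ i, ∑ j, u x j * G x i j * u x i

/-- The squared norm `‖∇u‖₂²`, where `H` is the gradient of `u`. -/
noncomputable def gradNormSq (Ω : Set E3) (H : E3 → Matrix (Fin 3) (Fin 3) ℝ) : ℝ :=
  ∫ x in Ω, ∑ i, ∑ j, (H x i j) ^ 2

/-- The Leray-Hopf extension condition for the boundary data `v` on the boundary of `Ω` with
surface measure `σ`: for every `ε > 0` there is a solenoidal extension `V` of `v` in `W^{1,2}(Ω)`
such that `-(u · ∇V, u) ≤ ε ‖∇u‖₂²` for every solenoidal `u` in `W^{1,2}_0(Ω)`. -/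
def LerayHopfEC (Ω : Set E3) (σ : Measure E3) (v : E3 → E3) : Prop :=
  ∀ ε : ℝ, 0 < ε → ∃ (V : E3 → E3) (G : E3 → Matrix (Fin 3) (Fin 3) ℝ),
    IsW12 Ω V G ∧ IsSolenoidal Ω G ∧ HasTrace Ω σ V G v ∧
    ∀ (u : E3 → E3) (H : E3 → Matrix (Fin 3) (Fin 3) ℝ),
      IsW120 Ω u H → IsSolenoidal Ω H → -convectionForm Ω u G ≤ ε * gradNormSq Ω H

/-! The obstruction comes from finitely many solenoidal test fields, chosen before `V`, whose
weighted tensor sum `∑ w u ⊗ u` has the form `A(x) I + b(|x|²) x ⊗ x`, with `b` supported in `(R₁²,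
R₂²)`. Pairing this sum with `∇V` kills the isotropic part because `div V = 0`, and leaves `∫
b(|x|²) xᵢ xⱼ ∂Vᵢ/∂xⱼ`. That integral depends only on the outward flux. Indeed, if `F(s) = s b(s) +
∫₀ˢ b`, then `b (V·x) x - F V` has divergence `b xᵢ xⱼ ∂Vᵢ/∂xⱼ - F div V`, and its flux through the
outer sphere is `-J Φ`, where `J = ∫₀^{R₂²} b`. The extension condition then gives `J Φ ≤ ε K` for
every `ε > 0`, with `K` depending only on the test fields; this is impossible once `J > 0`.

The test fields are `curl (η(|x|²) C(a·x) a × x)`, with `C` the cosine or the sine of frequency `N`.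
Adding the two phases removes the oscillation (`testField_cos_sin`), and a weighted sum over seven
axes `a` makes the tensor isotropic (`sum_testField_mul_testField`). The leading term of `b` is `28
N² η²`, so a large `N` makes `J` positive (`exists_integral_radialWeight_pos`). The flux identity is
`divergence_radial_combination` together with the divergence theorem on a ball; it passes from
smooth fields to `W^{1,2}` in `setIntegral_shell_radial_of_hasTrace`. -/

/-! ### Surface integrals and spherical coordinates -/

/-- The integral of `h` over the sphere of radius `r` centred at the origin. -/
noncomputable def sphereIntegral (h : E3 → ℝ) (r : ℝ) : ℝ :=
  r ^ 2 * ∫ z : Metric.sphere (0 : E3) 1, h (r • (z : E3)) ∂(volume : Measure E3).toSphere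

theorem continuous_sphereIntegral {h : E3 → ℝ} (hh : Continuous h) :
    Continuous (sphereIntegral h) := by
  unfold sphereIntegral
  refine (continuous_pow 2).mul ?_
  have := continuous_parametric_integral_of_continuous (μ := (volume : Measure E3).toSphere)
    (f := fun (r : ℝ) (z : Metric.sphere (0 : E3) 1) => h (r • (z : E3)))
    (hh.comp (continuous_fst.smul (continuous_subtype_val.comp continuous_snd))) isCompact_univ
  simpa using this

theorem integral_sphereMeasure {h : E3 → ℝ} (hh : Continuous h) (R : ℝ) :
    ∫ x, h x ∂(sphereMeasure R) = sphereIntegral h R := by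
  rw [sphereMeasure, integral_smul_measure,
    integral_map (by fun_prop) hh.aestronglyMeasurable, ENNReal.toReal_ofReal (sq_nonneg R)]
  rfl

instance isFiniteMeasure_sphereMeasure (R : ℝ) : IsFiniteMeasure (sphereMeasure R) := by
  have : IsFiniteMeasure ((volume : Measure E3).toSphere.map
      (fun z : Metric.sphere (0 : E3) 1 => R • (z : E3))) := inferInstance
  exact Measure.smul_finite _ ENNReal.ofReal_ne_top

theorem ae_norm_eq_sphereMeasure {R : ℝ} (hR : 0 ≤ R) : ∀ᵐ x ∂(sphereMeasure R), ‖x‖ = R := by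
  refine Measure.ae_smul_measure ?_ _
  rw [ae_map_iff (by fun_prop) (measurableSet_eq_fun (by fun_prop) (by fun_prop))]
  refine Eventually.of_forall fun z => ?_
  rw [norm_smul, Real.norm_of_nonneg hR, norm_eq_of_mem_sphere, mul_one]

/-- Integration in spherical coordinates. -/
theorem integral_eq_integral_sphereIntegral {h : E3 → ℝ} (hh : Integrable h) :
    ∫ x, h x = ∫ r in Set.Ioi (0 : ℝ), sphereIntegral h r := by
  have mp := (volume : Measure E3).measurePreserving_homeomorphUnitSphereProd
  have emb := (homeomorphUnitSphereProd E3).measurableEmbedding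
  set g : Metric.sphere (0 : E3) 1 × Set.Ioi (0 : ℝ) → ℝ := fun p => h (p.2.1 • (p.1 : E3)) with hg
  have hgc : ∀ x : ({0}ᶜ : Set E3), g (homeomorphUnitSphereProd E3 x) = h x := by
    intro x
    have hx : ‖(x : E3)‖ ≠ 0 := norm_ne_zero_iff.2 x.2
    simp [hg, smul_smul, hx]
  have hint : Integrable g ((volume : Measure E3).toSphere.prod
      (Measure.volumeIoiPow (Module.finrank ℝ E3 - 1))) := by
    rw [← mp.integrable_comp_emb emb]
    have : (g ∘ homeomorphUnitSphereProd E3) = fun x : ({0}ᶜ : Set E3) => h x := funext hgc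
    rw [this]
    have := (integrableOn_iff_comap_subtypeVal (f := h) (μ := volume)
      (measurableSet_singleton (0 : E3)).compl).1 hh.integrableOn
    exact this
  calc ∫ x, h x = ∫ x : ({0}ᶜ : Set E3), h x.1 ∂((volume : Measure E3).comap (↑)) := by
        rw [integral_subtype_comap (measurableSet_singleton _).compl h, restrict_compl_singleton]
    _ = ∫ p, g p ∂(volume : Measure E3).toSphere.prod
          (Measure.volumeIoiPow (Module.finrank ℝ E3 - 1)) := by
        rw [← mp.integral_comp emb]
        exact integral_congr_ae (Eventually.of_forall fun x => (hgc x).symm)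
    _ = ∫ r : Set.Ioi (0 : ℝ), ∫ z : Metric.sphere (0 : E3) 1, h (r.1 • (z : E3))
          ∂(volume : Measure E3).toSphere ∂(Measure.volumeIoiPow (Module.finrank ℝ E3 - 1)) :=
        integral_prod_symm _ hint
    _ = _ := by
        -- The radial measure has density `r ^ 2`, which is the factor built into `sphereIntegral`.
        simp only [Measure.volumeIoiPow, ENNReal.ofReal]
        rw [integral_withDensity_eq_integral_smul (by fun_prop),
          integral_subtype_comap measurableSet_Ioi
            fun a : ℝ => Real.toNNReal (a ^ (Module.finrank ℝ E3 - 1)) •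
              ∫ z : Metric.sphere (0 : E3) 1, h (a • (z : E3)) ∂(volume : Measure E3).toSphere]
        refine setIntegral_congr_fun measurableSet_Ioi fun r hr => ?_
        simp [sphereIntegral, NNReal.smul_def, Real.coe_toNNReal _ (sq_nonneg r)]

/-! ### The divergence theorem on a ball -/

/-- The divergence of a vector field. -/
noncomputable def divergence (X : E3 → E3) (x : E3) : ℝ :=
  ∑ i, partialD i (fun y => X y i) x

theorem continuous_partialD {φ : E3 → ℝ} (hφ : ContDiff ℝ 1 φ) (j : Fin 3) :
    Continuous (partialD j φ) :=
  (hφ.continuous_fderiv one_ne_zero).clm_apply continuous_const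

theorem ContDiff.component {X : E3 → E3} {n : WithTop ℕ∞} (hX : ContDiff ℝ n X) (i : Fin 3) :
    ContDiff ℝ n fun y => X y i := by
  fun_prop

theorem continuous_divergence {X : E3 → E3} (hX : ContDiff ℝ 1 X) :
    Continuous (divergence X) :=
  continuous_finsetSum _ fun i _ => continuous_partialD (hX.component i) i

theorem hasCompactSupport_partialD {φ : E3 → ℝ} (h : HasCompactSupport φ) (j : Fin 3) :
    HasCompactSupport (partialD j φ) :=
  h.fderiv_apply (𝕜 := ℝ) _

/-- Integration by parts against a compactly supported function. -/
theorem integral_mul_partialD {f g : E3 → ℝ} (hf : ContDiff ℝ 1 f) (hg : ContDiff ℝ 1 g)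
    (hs : HasCompactSupport g) (j : Fin 3) :
    ∫ x, f x * partialD j g x = - ∫ x, partialD j f x * g x := by
  refine integral_mul_fderiv_eq_neg_fderiv_mul_of_integrable ?_ ?_ ?_
    (fun x _ => hf.differentiable one_ne_zero x) (fun x _ => hg.differentiable one_ne_zero x)
  · exact ((continuous_partialD hf j).mul hg.continuous).integrable_of_hasCompactSupport
      hs.mul_left
  · exact (hf.continuous.mul (continuous_partialD hg j)).integrable_of_hasCompactSupport
      (hasCompactSupport_partialD hs j).mul_left
  · exact (hf.continuous.mul hg.continuous).integrable_of_hasCompactSupport hs.mul_left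

theorem partialD_comp_normSq {κ κ' : ℝ → ℝ} (hκ : ∀ s, HasDerivAt κ (κ' s) s) (j : Fin 3)
    (x : E3) : partialD j (fun y => κ (‖y‖ ^ 2)) x = κ' (‖x‖ ^ 2) * (2 * x j) := by
  have h := (hκ (‖x‖ ^ 2)).comp_hasFDerivAt x (hasStrictFDerivAt_norm_sq x).hasFDerivAt
  have h2 := h.fderiv
  simp only [Function.comp_def] at h2
  rw [partialD, h2]
  simp [EuclideanSpace.inner_single_right]

theorem sphereIntegral_radial_mul (c h : E3 → ℝ) (k : ℝ → ℝ) (hc : ∀ x, c x = k ‖x‖) {r : ℝ}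
    (hr : 0 ≤ r) : sphereIntegral (fun x => c x * h x) r = k r * sphereIntegral h r := by
  have : ∀ z : Metric.sphere (0 : E3) 1, c (r • (z : E3)) * h (r • (z : E3))
      = k r * h (r • (z : E3)) := fun z => by
    rw [hc, norm_smul, norm_eq_of_mem_sphere, mul_one, Real.norm_of_nonneg hr]
  simp only [sphereIntegral, this, integral_const_mul]
  ring

theorem exists_pos_bound_of_hasCompactSupport {φ : ℝ → ℝ} (hφ : HasCompactSupport φ) :
    ∃ M, 0 < M ∧ ∀ r, M ≤ r → φ r = 0 := by
  obtain ⟨M, hM⟩ := hφ.isCompact.isBounded.subset_closedBall 0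
  refine ⟨max M 0 + 1, by positivity, fun r hr => image_eq_zero_of_notMem_tsupport fun h => ?_⟩
  have h1 := hM h
  have h2 := le_max_left M 0
  have h3 := le_abs_self r
  simp only [Metric.mem_closedBall, dist_zero_right, Real.norm_eq_abs] at h1
  linarith

/-- The divergence theorem on all balls at once, tested against a radial profile `φ`. Integrating
`div X` against a radial function with gradient `φ(|x|) x` produces `X·x` on one side; on the other,
an integration by parts in `r` replaces the radial function by `φ` and the sphere integrals of `div
X` by their primitive. -/
theorem integral_radial_weak_divergence {X : E3 → E3} (hX : ContDiff ℝ 1 X) {φ : ℝ → ℝ}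
    (hφ : Continuous φ) (hs : HasCompactSupport φ) :
    ∫ r in Set.Ioi (0 : ℝ), φ r * (r * ∫ t in (0 : ℝ)..r, sphereIntegral (divergence X) t) =
      ∫ r in Set.Ioi (0 : ℝ), φ r * sphereIntegral (fun x => inner ℝ (X x) x) r := by
  obtain ⟨M, hM0, hM⟩ := exists_pos_bound_of_hasCompactSupport hs
  have hm : Continuous fun s : ℝ => φ (√s) / 2 := by fun_prop
  -- The chain rule for `κ(|x|²)` contributes `2 x`, which the factor `1 / 2` compensates. Starting
  -- the primitive at `M ^ 2`, beyond the support of `φ`, makes `κ(|x|²)` compactly supported.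
  set κ : ℝ → ℝ := fun s => ∫ t in (M ^ 2)..s, φ (√t) / 2 with hκdef
  have hκ : ∀ s, HasDerivAt κ (φ (√s) / 2) s := fun s =>
    intervalIntegral.integral_hasDerivAt_right (hm.intervalIntegrable _ _)
      (hm.stronglyMeasurableAtFilter _ _) hm.continuousAt
  have hκ0 : ∀ s, M ^ 2 ≤ s → κ s = 0 := by
    intro s h
    refine intervalIntegral.integral_zero_ae (Eventually.of_forall fun t ht => ?_)
    rw [Set.uIoc_of_le h] at ht
    rw [hM _ (Real.le_sqrt_of_sq_le ht.1.le), zero_div]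
  have hκC : ContDiff ℝ 1 κ := by
    rw [contDiff_one_iff_deriv]
    exact ⟨fun s => (hκ s).differentiableAt, by rwa [funext fun s => (hκ s).deriv]⟩
  set K : E3 → ℝ := fun x => κ (‖x‖ ^ 2) with hK
  have hKC : ContDiff ℝ 1 K := hκC.comp (contDiff_norm_sq ℝ)
  have hKs : HasCompactSupport K := by
    refine HasCompactSupport.intro (isCompact_closedBall (0 : E3) M) fun x hx => hκ0 _ ?_
    rw [Metric.mem_closedBall, dist_zero_right, not_le] at hx
    gcongr
  have hparts : ∀ i : Fin 3, ∫ x, K x * partialD i (fun y => X y i) x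
      = - ∫ x, φ ‖x‖ * (x i * X x i) := by
    intro i
    have h1 := integral_mul_partialD (hX.component i) hKC hKs i
    have h2 : ∀ x, partialD i K x = φ ‖x‖ * x i := fun x => by
      rw [hK, partialD_comp_normSq hκ, Real.sqrt_sq (norm_nonneg x)]; ring
    rw [neg_eq_iff_eq_neg.symm, eq_comm] at h1
    simp only [h2] at h1
    calc _ = ∫ x, partialD i (fun y => X y i) x * K x := by simp only [mul_comm]
      _ = _ := by
        rw [h1]; congr 1; refine integral_congr_ae (Eventually.of_forall fun x => ?_)
        simp only; ring
  have hφs : HasCompactSupport fun x : E3 => φ ‖x‖ := by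
    refine HasCompactSupport.intro (isCompact_closedBall (0 : E3) M) fun x hx => hM _ ?_
    rw [Metric.mem_closedBall, dist_zero_right, not_le] at hx
    exact hx.le
  have hinner : ∀ x, inner ℝ (X x) x = ∑ i, x i * X x i := fun x => by
    simp [PiLp.inner_apply]
  have key : ∫ x, K x * divergence X x = - ∫ x, φ ‖x‖ * inner ℝ (X x) x := by
    simp only [divergence, hinner, Finset.mul_sum]
    rw [integral_finsetSum, integral_finsetSum, ← Finset.sum_neg_distrib]
    · exact Finset.sum_congr rfl fun i _ => hparts i
    · intro i _
      refine Continuous.integrable_of_hasCompactSupport ?_ hφs.mul_right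
      have := hX.continuous
      fun_prop
    · intro i _
      exact (hKC.continuous.mul (continuous_partialD (hX.component i) i)).integrable_of_hasCompactSupport
        hKs.mul_right
  have hD := continuous_sphereIntegral (continuous_divergence hX)
  have hin : Continuous fun x : E3 => inner ℝ (X x) x := hX.continuous.inner continuous_id
  have i1 : Integrable fun x => K x * divergence X x := (hKC.continuous.mul
    (continuous_divergence hX)).integrable_of_hasCompactSupport hKs.mul_right
  have i2 : Integrable fun x => φ ‖x‖ * inner ℝ (X x) x := ((hφ.comp continuous_norm).mul
    hin).integrable_of_hasCompactSupport hφs.mul_right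
  rw [integral_eq_integral_sphereIntegral i1, integral_eq_integral_sphereIntegral i2] at key
  have e1 : ∫ r in Set.Ioi (0 : ℝ), sphereIntegral (fun x => K x * divergence X x) r
      = ∫ r in Set.Ioi (0 : ℝ), κ (r ^ 2) * sphereIntegral (divergence X) r :=
    setIntegral_congr_fun measurableSet_Ioi fun r hr =>
      sphereIntegral_radial_mul K _ (fun r => κ (r ^ 2)) (fun _ => rfl) (le_of_lt hr)
  have e2 : ∫ r in Set.Ioi (0 : ℝ), sphereIntegral (fun x => φ ‖x‖ * inner ℝ (X x) x) r
      = ∫ r in Set.Ioi (0 : ℝ), φ r * sphereIntegral (fun x => inner ℝ (X x) x) r :=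
    setIntegral_congr_fun measurableSet_Ioi fun r hr =>
      sphereIntegral_radial_mul _ _ φ (fun _ => rfl) (le_of_lt hr)
  have cut : ∀ g : ℝ → ℝ, (∀ r, M ≤ r → g r = 0) →
      ∫ r in Set.Ioi (0 : ℝ), g r = ∫ r in (0 : ℝ)..M, g r := by
    intro g hg
    rw [intervalIntegral.integral_of_le hM0.le]
    refine setIntegral_eq_of_subset_of_forall_sdiff_eq_zero measurableSet_Ioi
      Set.Ioc_subset_Ioi_self fun r hr => hg r ?_
    by_contra! h
    exact hr.2 ⟨hr.1, h.le⟩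
  set E : ℝ → ℝ := fun r => ∫ t in (0 : ℝ)..r, sphereIntegral (divergence X) t with hE
  have hEd : ∀ r, HasDerivAt E (sphereIntegral (divergence X) r) r := fun r =>
    intervalIntegral.integral_hasDerivAt_right (hD.intervalIntegrable _ _)
      (hD.stronglyMeasurableAtFilter _ _) hD.continuousAt
  have hEc : Continuous E := continuous_iff_continuousAt.2 fun r => (hEd r).continuousAt
  have hκd : ∀ r : ℝ, HasDerivAt (fun r => κ (r ^ 2)) (φ |r| * r) r := fun r => by
    have := (hκ (r ^ 2)).comp r (hasDerivAt_pow 2 r)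
    rw [Real.sqrt_sq_eq_abs] at this
    convert! this using 1
    simp; ring
  have ibp := intervalIntegral.integral_mul_deriv_eq_deriv_mul (a := 0) (b := M)
    (fun r _ => hκd r) (fun r _ => hEd r)
    (Continuous.intervalIntegrable (by fun_prop) _ _) (hD.intervalIntegrable _ _)
  have hE0 : E 0 = 0 := intervalIntegral.integral_same
  -- Both boundary terms vanish: `κ` at `M ^ 2`, and `E` at `0`.
  rw [hκ0 _ le_rfl, hE0, zero_mul, mul_zero, sub_zero, zero_sub] at ibp
  rw [e1, e2, cut _ fun r hr => by rw [hκ0 _ (by gcongr), zero_mul], ibp, neg_inj] at key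
  rw [← key, cut _ fun r hr => by rw [hM r hr, zero_mul]]
  refine intervalIntegral.integral_congr fun r hr => ?_
  rw [Set.uIcc_of_le hM0.le] at hr
  simp only [abs_of_nonneg hr.1]
  ring

/-- The weak identity holds for every profile `φ`, so the two sides agree for almost every `r > 0`;
both are continuous in `r`, hence they agree for every `r > 0`. -/
theorem integral_sphereIntegral_divergence {X : E3 → E3} (hX : ContDiff ℝ 1 X) {r : ℝ}
    (hr : 0 < r) :
    r * ∫ t in (0 : ℝ)..r, sphereIntegral (divergence X) t =
      sphereIntegral (fun x => inner ℝ (X x) x) r := by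
  have hD := continuous_sphereIntegral (continuous_divergence hX)
  have hc1 : Continuous fun r : ℝ => r * ∫ t in (0 : ℝ)..r, sphereIntegral (divergence X) t :=
    continuous_id.mul (intervalIntegral.continuous_primitive
      (fun a b => hD.intervalIntegrable a b) 0)
  have hc2 := continuous_sphereIntegral (hX.continuous.inner (𝕜 := ℝ) continuous_id)
  have hae := isOpen_Ioi.ae_eq_zero_of_integral_contDiff_smul_eq_zero (U := Set.Ioi (0 : ℝ))
    (μ := volume) (f := fun r => (r * ∫ t in (0 : ℝ)..r, sphereIntegral (divergence X) t) -
      sphereIntegral (fun x => inner ℝ (X x) x) r)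
    ((hc1.sub hc2).locallyIntegrable.locallyIntegrableOn _) ?_
  · have := Measure.eqOn_open_of_ae_eq (μ := (volume : Measure ℝ)) (U := Set.Ioi (0 : ℝ))
      (f := fun r => (r * ∫ t in (0 : ℝ)..r, sphereIntegral (divergence X) t))
      (g := sphereIntegral (fun x => inner ℝ (X x) x))
      ((ae_restrict_iff' measurableSet_Ioi).2 (hae.mono fun r h hr => sub_eq_zero.1 (h hr)))
      isOpen_Ioi hc1.continuousOn hc2.continuousOn
    exact this hr
  · intro g hg hgs hgU
    have h0 : ∀ r, r ∉ Set.Ioi (0 : ℝ) → g r • ((r * ∫ t in (0 : ℝ)..r,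
        sphereIntegral (divergence X) t) - sphereIntegral (fun x => inner ℝ (X x) x) r) = 0 :=
      fun r hr => by
        rw [image_eq_zero_of_notMem_tsupport fun h => hr (hgU h), zero_smul]
    rw [← setIntegral_eq_integral_of_forall_compl_eq_zero h0]
    simp only [smul_eq_mul, mul_sub]
    rw [integral_sub, integral_radial_weak_divergence hX hg.continuous hgs, sub_self]
    · exact ((hg.continuous.mul hc1).integrable_of_hasCompactSupport hgs.mul_right).integrableOn
    · exact ((hg.continuous.mul hc2).integrable_of_hasCompactSupport hgs.mul_right).integrableOn

/-- The divergence theorem on a ball centred at the origin. -/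
theorem integral_ball_divergence {X : E3 → E3} (hX : ContDiff ℝ 1 X) {R : ℝ} (hR : 0 < R) :
    ∫ x in Metric.ball (0 : E3) R, divergence X x =
      ∫ x, inner ℝ (X x) (R⁻¹ • x) ∂(sphereMeasure R) := by
  have hdiv := continuous_divergence hX
  rw [integral_sphereMeasure (hX.continuous.inner (by fun_prop))]
  have hint : IntegrableOn (divergence X) (Metric.ball 0 R) :=
    (hdiv.continuousOn.integrableOn_compact (isCompact_closedBall _ _)).mono_set
      Metric.ball_subset_closedBall
  have h1 : sphereIntegral (fun x => inner ℝ (X x) (R⁻¹ • x)) R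
      = R⁻¹ * sphereIntegral (fun x => inner ℝ (X x) x) R := by
    simp only [inner_smul_right, sphereIntegral, integral_const_mul]
    ring
  rw [h1, ← integral_sphereIntegral_divergence hX hR, inv_mul_cancel_left₀ hR.ne',
    ← integral_indicator measurableSet_ball,
    integral_eq_integral_sphereIntegral (hint.integrable_indicator measurableSet_ball),
    intervalIntegral.integral_of_le hR.le, integral_Ioc_eq_integral_Ioo,
    setIntegral_eq_of_subset_of_forall_sdiff_eq_zero (s := Set.Ioo 0 R) measurableSet_Ioi
      Set.Ioo_subset_Ioi_self]
  · refine setIntegral_congr_fun measurableSet_Ioo fun r hr => ?_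
    have : ∀ z : Metric.sphere (0 : E3) 1, (Metric.ball (0 : E3) R).indicator (divergence X)
        (r • (z : E3)) = divergence X (r • (z : E3)) := fun z => Set.indicator_of_mem (by
      rw [mem_ball_zero_iff, norm_smul, norm_eq_of_mem_sphere, mul_one,
        Real.norm_of_nonneg hr.1.le]
      exact hr.2) _
    simp only [sphereIntegral, this]
  · intro r hr
    have hr0 : 0 < r := hr.1
    have : ∀ z : Metric.sphere (0 : E3) 1, (Metric.ball (0 : E3) R).indicator (divergence X)
        (r • (z : E3)) = 0 := fun z => Set.indicator_of_notMem (by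
      rw [mem_ball_zero_iff, norm_smul, norm_eq_of_mem_sphere, mul_one, Real.norm_of_nonneg hr0.le]
      exact fun h => hr.2 ⟨hr0, h⟩) _
    simp only [sphereIntegral, this, integral_zero, mul_zero]

/-! ### Calculus of the divergence -/

theorem sum_mul_partialD (φ : E3 → ℝ) (x v : E3) :
    ∑ i, v i * partialD i φ x = fderiv ℝ φ x v := by
  have hv : v = ∑ i, v i • EuclideanSpace.single i (1 : ℝ) := by
    ext j
    simp [Pi.single_apply]
  conv_rhs => rw [hv]
  simp [partialD]

theorem divergence_smul {f : E3 → ℝ} {Y : E3 → E3} {x : E3} (hf : DifferentiableAt ℝ f x)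
    (hY : DifferentiableAt ℝ Y x) :
    divergence (fun y => f y • Y y) x = f x * divergence Y x + fderiv ℝ f x (Y x) := by
  rw [← sum_mul_partialD, divergence, divergence, Finset.mul_sum, ← Finset.sum_add_distrib]
  refine Finset.sum_congr rfl fun i _ => ?_
  have hYi : DifferentiableAt ℝ (fun y => Y y i) x := by fun_prop
  simp only [partialD, PiLp.smul_apply, smul_eq_mul]
  rw [fderiv_fun_mul hf hYi]
  simp

theorem divergence_sub {Y Z : E3 → E3} {x : E3} (hY : DifferentiableAt ℝ Y x)
    (hZ : DifferentiableAt ℝ Z x) :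
    divergence (fun y => Y y - Z y) x = divergence Y x - divergence Z x := by
  rw [divergence, divergence, divergence, ← Finset.sum_sub_distrib]
  refine Finset.sum_congr rfl fun i _ => ?_
  have hYi : DifferentiableAt ℝ (fun y => Y y i) x := by fun_prop
  have hZi : DifferentiableAt ℝ (fun y => Z y i) x := by fun_prop
  simp only [partialD, PiLp.sub_apply]
  rw [fderiv_fun_sub hYi hZi]
  simp

theorem divergence_const (a x : E3) : divergence (fun _ => a) x = 0 := by
  simp [divergence, partialD]

theorem divergence_id (x : E3) : divergence id x = 3 := by
  have : ∀ i : Fin 3, partialD i (fun y : E3 => y i) x = 1 := fun i => by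
    have h : HasFDerivAt (fun y : E3 => y i) (EuclideanSpace.proj i : E3 →L[ℝ] ℝ) x :=
      (EuclideanSpace.proj i : E3 →L[ℝ] ℝ).hasFDerivAt
    rw [partialD, h.fderiv]
    simp
  simp [divergence, this]

theorem trace_gradField (V : E3 → E3) (x : E3) : (gradField V x).trace = divergence V x := rfl

/-! ### Solenoidal test fields -/

/-- The solenoidal field `curl (η(|x|²) C(a·x) a × x)`. -/
noncomputable def testField (η C : ℝ → ℝ) (a x : E3) : E3 :=
  ((2 * ‖x‖ ^ 2 * deriv η (‖x‖ ^ 2) + 2 * η (‖x‖ ^ 2)) * C (inner ℝ a x) +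
      η (‖x‖ ^ 2) * deriv C (inner ℝ a x) * inner ℝ a x) • a -
    (2 * deriv η (‖x‖ ^ 2) * inner ℝ a x * C (inner ℝ a x) +
      η (‖x‖ ^ 2) * deriv C (inner ℝ a x) * ‖a‖ ^ 2) • x

theorem ContDiff.deriv_infty {f : ℝ → ℝ} (hf : ContDiff ℝ ∞ f) : ContDiff ℝ ∞ (deriv f) :=
  (contDiff_infty_iff_deriv.1 hf).2

theorem contDiff_testField {η C : ℝ → ℝ} (hη : ContDiff ℝ ∞ η) (hC : ContDiff ℝ ∞ C) (a : E3) :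
    ContDiff ℝ ∞ (testField η C a) := by
  have h1 := hη.deriv_infty
  have h2 := hC.deriv_infty
  have hs : ContDiff ℝ ∞ fun x : E3 => ‖x‖ ^ 2 := contDiff_norm_sq ℝ
  have ht : ContDiff ℝ ∞ fun x : E3 => inner ℝ a x := contDiff_const.inner ℝ contDiff_id
  unfold testField
  have e1 := hη.comp hs
  have e2 := h1.comp hs
  have e3 := hC.comp ht
  have e4 := h2.comp ht
  simp only [Function.comp_def] at e1 e2 e3 e4
  fun_prop

theorem hasFDerivAt_comp_normSq {f : ℝ → ℝ} (hf : ContDiff ℝ ∞ f) (x : E3) :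
    HasFDerivAt (fun y : E3 => f (‖y‖ ^ 2)) (deriv f (‖x‖ ^ 2) • (2 • innerSL ℝ x)) x :=
  (hf.differentiable (by simp) _).hasDerivAt.comp_hasFDerivAt x
    (hasStrictFDerivAt_norm_sq x).hasFDerivAt

theorem hasFDerivAt_comp_inner {f : ℝ → ℝ} (hf : ContDiff ℝ ∞ f) (a x : E3) :
    HasFDerivAt (fun y : E3 => f (inner ℝ a y)) (deriv f (inner ℝ a x) • innerSL ℝ a) x :=
  (hf.differentiable (by simp) _).hasDerivAt.comp_hasFDerivAt x (innerSL ℝ a).hasFDerivAt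

/-- The divergence of a curl vanishes. As `testField` is the curl already expanded, in the form `α a
- β x`, the cancellation is checked through `a·∇α - x·∇β - 3 β = 0`. -/
theorem divergence_testField {η C : ℝ → ℝ} (hη : ContDiff ℝ ∞ η) (hC : ContDiff ℝ ∞ C)
    (a x : E3) : divergence (testField η C a) x = 0 := by
  have hs := (hasStrictFDerivAt_norm_sq x).hasFDerivAt
  have ht : HasFDerivAt (fun y : E3 => inner ℝ a y) (innerSL ℝ a) x := (innerSL ℝ a).hasFDerivAt
  have e0 := hasFDerivAt_comp_normSq hη x
  have e1 := hasFDerivAt_comp_normSq hη.deriv_infty x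
  have c0 := hasFDerivAt_comp_inner hC a x
  have c1 := hasFDerivAt_comp_inner hC.deriv_infty a x
  have hα := ((((hs.const_mul 2).mul e1).add (e0.const_mul 2)).mul c0).add ((e0.mul c1).mul ht)
  have hβ := (((e1.const_mul 2).mul ht).mul c0).add ((e0.mul c1).mul_const (‖a‖ ^ 2))
  have hd := divergence_sub (hα.differentiableAt.smul (differentiableAt_const (c := a)))
    (hβ.differentiableAt.smul differentiableAt_id)
  have hd1 := divergence_smul hα.differentiableAt (differentiableAt_const (x := x) (c := a))
  have hd2 := divergence_smul hβ.differentiableAt (differentiableAt_id (x := x))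
  rw [hα.fderiv, divergence_const] at hd1
  rw [hβ.fderiv] at hd2
  rw [divergence_id] at hd2
  change divergence (testField η C a) x = _ at hd
  refine (hd.trans (congrArg₂ _ hd1 hd2)).trans ?_
  simp [real_inner_comm]
  ring

theorem testField_eq_zero {η C : ℝ → ℝ} {a x : E3} (h : ‖x‖ ^ 2 ∉ tsupport η) :
    testField η C a x = 0 := by
  have h0 : η (‖x‖ ^ 2) = 0 := image_eq_zero_of_notMem_tsupport h
  have h1 : deriv η (‖x‖ ^ 2) = 0 := by
    by_contra h'
    exact h (support_deriv_subset h')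
  simp [testField, h0, h1]

theorem tsupport_testField_subset (η C : ℝ → ℝ) (a : E3) :
    tsupport (testField η C a) ⊆ {x | ‖x‖ ^ 2 ∈ tsupport η} := by
  refine closure_minimal (fun x hx => ?_) ((isClosed_tsupport η).preimage (by fun_prop))
  by_contra h
  exact hx (testField_eq_zero h)

theorem hasCompactSupport_testField {η : ℝ → ℝ} (hη : HasCompactSupport η) (C : ℝ → ℝ) (a : E3) :
    HasCompactSupport (testField η C a) := by
  obtain ⟨M, hM⟩ := hη.isCompact.isBounded.subset_closedBall 0
  refine (isCompact_closedBall (0 : E3) (√M)).of_isClosed_subset (isClosed_tsupport _)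
    fun x hx => ?_
  have h := hM (tsupport_testField_subset η C a hx)
  rw [Metric.mem_closedBall, dist_zero_right, Real.norm_of_nonneg (by positivity)] at h
  rw [Metric.mem_closedBall, dist_zero_right]
  exact Real.le_sqrt_of_sq_le h

theorem hasCompactSupport_component {X : E3 → E3} (h : HasCompactSupport X) (i : Fin 3) :
    HasCompactSupport fun y => X y i :=
  h.comp_left (g := fun y : E3 => y i) rfl

/-- Smooth fields with compact support in `Ω` belong to `W^{1,2}_0(Ω)`. -/
theorem isW120_of_contDiff {Ω : Set E3} {U : E3 → E3} (hU : ContDiff ℝ ∞ U)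
    (hc : HasCompactSupport U) (hs : tsupport U ⊆ Ω) : IsW120 Ω U (gradField U) := by
  have hU1 : ContDiff ℝ 1 U := hU.of_le (by simp)
  refine ⟨⟨hU.continuous.memLp_of_hasCompactSupport hc, fun i j => ?_, ?_⟩, fun _ => U,
    fun _ => ⟨hU, hc, hs⟩, by simp, by simp⟩
  · exact (continuous_partialD (hU1.component i) j).memLp_of_hasCompactSupport
      (hasCompactSupport_partialD (hasCompactSupport_component hc i) j)
  · intro φ hφ hφc hφs i j
    rw [setIntegral_eq_integral_of_forall_compl_eq_zero,
      setIntegral_eq_integral_of_forall_compl_eq_zero]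
    · exact integral_mul_partialD (hU1.component i) (hφ.of_le (by simp)) hφc j
    · intro x hx
      rw [image_eq_zero_of_notMem_tsupport fun h => hx (hφs h), mul_zero]
    · intro x hx
      rw [image_eq_zero_of_notMem_tsupport fun h => hx (hs h)]
      simp

/-- The field has the form `C P + C' Q`, where `P` and `Q` do not depend on `C`. For cosine and sine
of frequency `N`, the sums of `C²`, `C C'` and `C'²` over the two phases are `1`, `0` and `N²`,
which leaves `P ⊗ P + N² Q ⊗ Q`. -/
theorem testField_cos_sin (η : ℝ → ℝ) (N : ℝ) (a x : E3) (i j : Fin 3) :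
    testField η (fun t => Real.cos (N * t)) a x i * testField η (fun t => Real.cos (N * t)) a x j +
      testField η (fun t => Real.sin (N * t)) a x i * testField η (fun t => Real.sin (N * t)) a x j
    = ((2 * ‖x‖ ^ 2 * deriv η (‖x‖ ^ 2) + 2 * η (‖x‖ ^ 2)) * a i -
          2 * deriv η (‖x‖ ^ 2) * inner ℝ a x * x i) *
        ((2 * ‖x‖ ^ 2 * deriv η (‖x‖ ^ 2) + 2 * η (‖x‖ ^ 2)) * a j -
          2 * deriv η (‖x‖ ^ 2) * inner ℝ a x * x j) +
      N ^ 2 * η (‖x‖ ^ 2) ^ 2 * ((inner ℝ a x * a i - ‖a‖ ^ 2 * x i) *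
        (inner ℝ a x * a j - ‖a‖ ^ 2 * x j)) := by
  have hc : ∀ t, deriv (fun t => Real.cos (N * t)) t = -(N * Real.sin (N * t)) := fun t => by
    have := ((Real.hasDerivAt_cos (N * t)).comp t ((hasDerivAt_id t).const_mul N)).deriv
    simp only [Function.comp_def] at this
    rw [this]; ring
  have hs : ∀ t, deriv (fun t => Real.sin (N * t)) t = N * Real.cos (N * t) := fun t => by
    have := ((Real.hasDerivAt_sin (N * t)).comp t ((hasDerivAt_id t).const_mul N)).deriv
    simp only [Function.comp_def] at this
    rw [this]; ring
  simp only [testField, hc, hs, PiLp.sub_apply, PiLp.smul_apply, smul_eq_mul]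
  generalize inner ℝ a x = t
  generalize deriv η (‖x‖ ^ 2) = η'
  generalize η (‖x‖ ^ 2) = e
  generalize ‖x‖ ^ 2 = s
  generalize ‖a‖ ^ 2 = n
  have h := Real.sin_sq_add_cos_sq (N * t)
  generalize Real.sin (N * t) = S at *
  generalize Real.cos (N * t) = C at *
  -- The cross terms cancel, and the left side is the right side multiplied by `S² + C²`.
  linear_combination (((2 * s * η' + 2 * e) * a i - 2 * η' * t * x i) *
    ((2 * s * η' + 2 * e) * a j - 2 * η' * t * x j) + N ^ 2 * e ^ 2 *
    ((t * a i - n * x i) * (t * a j - n * x j))) * h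

/-! ### Isotropic superposition of the test fields -/

/-- The axes through the vertices of an octahedron and of a cube. -/
noncomputable def axis : Fin 7 → E3 :=
  ![!₂[1, 0, 0], !₂[0, 1, 0], !₂[0, 0, 1], !₂[1, 1, 1], !₂[1, 1, -1], !₂[1, -1, 1], !₂[-1, 1, 1]]

/-- Weights for which the fourth moments of the axes are isotropic. -/
def axisWeight : Fin 7 → ℝ := ![8, 8, 8, 1, 1, 1, 1]

theorem axisWeight_nonneg (k : Fin 7) : 0 ≤ axisWeight k := by
  fin_cases k <;> simp [axisWeight]

/-- The radial part of the isotropic tensor obtained by summing the test fields. -/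
noncomputable def radialWeight (η : ℝ → ℝ) (N s : ℝ) : ℝ :=
  28 * N ^ 2 * η s ^ 2 - 48 * deriv η s * (s * deriv η s + 2 * η s)

/-- The weighted axes have second moments `12 δᵢⱼ` and fourth moments `4 (δᵢⱼ δₖₗ + δᵢₖ δⱼₗ + δᵢₗ
δⱼₖ)`: the weights `8` and `1` make `∑ w a₁⁴ = 12` three times `∑ w a₁² a₂² = 4`. Hence only `δᵢⱼ`
and `xᵢ xⱼ` can appear. -/
theorem sum_testField_mul_testField (η : ℝ → ℝ) (N : ℝ) (x : E3) (i j : Fin 3) :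
    ∑ k, axisWeight k *
      (testField η (fun t => Real.cos (N * t)) (axis k) x i *
          testField η (fun t => Real.cos (N * t)) (axis k) x j +
        testField η (fun t => Real.sin (N * t)) (axis k) x i *
          testField η (fun t => Real.sin (N * t)) (axis k) x j)
    = (12 * (2 * ‖x‖ ^ 2 * deriv η (‖x‖ ^ 2) + 2 * η (‖x‖ ^ 2)) ^ 2 +
        4 * N ^ 2 * η (‖x‖ ^ 2) ^ 2 * ‖x‖ ^ 2) * (if i = j then 1 else 0) +
      radialWeight η N (‖x‖ ^ 2) * (x i * x j) := by
  simp only [testField_cos_sin, radialWeight]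
  generalize deriv η (‖x‖ ^ 2) = η'
  generalize η (‖x‖ ^ 2) = e
  have hx : ‖x‖ ^ 2 = x 0 ^ 2 + x 1 ^ 2 + x 2 ^ 2 := by
    rw [EuclideanSpace.real_norm_sq_eq, Fin.sum_univ_three]
  rw [hx]
  have ha : ∀ k, ‖axis k‖ ^ 2 = axis k 0 ^ 2 + axis k 1 ^ 2 + axis k 2 ^ 2 := fun k => by
    rw [EuclideanSpace.real_norm_sq_eq, Fin.sum_univ_three]
  have hi : ∀ k, inner ℝ (axis k) x = axis k 0 * x 0 + axis k 1 * x 1 + axis k 2 * x 2 :=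
    fun k => by
      rw [PiLp.inner_apply, Fin.sum_univ_three]
      simp [mul_comm]
  simp only [ha, hi, Fin.sum_univ_seven]
  fin_cases i <;> fin_cases j <;> simp [axis, axisWeight] <;> ring

/-! ### The flux identity on the shell, and its extension to `W^{1,2}` -/

/-- Convergence in `L²` of a finite measure implies convergence of the integrals against a
bounded function. -/
theorem tendsto_integral_inner_of_tendsto_eLpNorm {E : Type*} [NormedAddCommGroup E]
    [InnerProductSpace ℝ E] {μ : Measure E3} [IsFiniteMeasure μ] {f c : E3 → E}
    {F : ℕ → E3 → E} {M : ℝ} (hf : MemLp f 2 μ) (hF : ∀ k, AEStronglyMeasurable (F k) μ)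
    (hc : AEStronglyMeasurable c μ) (hM : ∀ᵐ x ∂μ, ‖c x‖ ≤ M)
    (h : Tendsto (fun k => eLpNorm (fun x => F k x - f x) 2 μ) atTop (𝓝 0)) :
    Tendsto (fun k => ∫ x, inner ℝ (F k x) (c x) ∂μ) atTop (𝓝 (∫ x, inner ℝ (f x) (c x) ∂μ)) := by
  have hbd : ∀ g : E3 → E, AEStronglyMeasurable g μ →
      eLpNorm (fun x => inner ℝ (g x) (c x)) 1 μ
        ≤ ENNReal.ofReal M * (eLpNorm g 2 μ * μ Set.univ ^ (1 / (1 : ℝ≥0∞).toReal -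
          1 / (2 : ℝ≥0∞).toReal)) := by
    intro g hg
    refine (eLpNorm_le_mul_eLpNorm_of_ae_le_mul (g := g) (c := M) ?_ 1).trans ?_
    · filter_upwards [hM] with x hx
      calc ‖inner ℝ (g x) (c x)‖ ≤ ‖g x‖ * ‖c x‖ := norm_inner_le_norm _ _
        _ ≤ M * ‖g x‖ := by rw [mul_comm]; gcongr
    · gcongr
      exact eLpNorm_le_eLpNorm_mul_rpow_measure_univ (by norm_num) hg
  have hfin : μ Set.univ ^ (1 / (1 : ℝ≥0∞).toReal - 1 / (2 : ℝ≥0∞).toReal) ≠ ⊤ :=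
    ENNReal.rpow_ne_top_of_nonneg (by norm_num) (measure_ne_top _ _)
  have hint : ∀ g : E3 → E, MemLp g 2 μ → Integrable (fun x => inner ℝ (g x) (c x)) μ := by
    intro g hg
    rw [← memLp_one_iff_integrable]
    refine ⟨hg.1.inner hc, (hbd g hg.1).trans_lt ?_⟩
    exact ENNReal.mul_lt_top ENNReal.ofReal_lt_top
      (ENNReal.mul_lt_top hg.2 hfin.lt_top)
  refine tendsto_integral_of_L1' _ (hint f hf).1 ?_ ?_
  · filter_upwards [h.eventually (gt_mem_nhds ENNReal.zero_lt_top)] with k hk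
    refine hint _ ?_
    have : MemLp (fun x => F k x - f x) 2 μ := ⟨(hF k).sub hf.1, hk⟩
    exact (this.add hf).ae_eq (Eventually.of_forall fun x => by simp)
  · have h0 : Tendsto (fun k => ENNReal.ofReal M * (eLpNorm (fun x => F k x - f x) 2 μ *
        μ Set.univ ^ (1 / (1 : ℝ≥0∞).toReal - 1 / (2 : ℝ≥0∞).toReal))) atTop (𝓝 0) := by
      have := ENNReal.Tendsto.const_mul (a := ENNReal.ofReal M)
        (ENNReal.Tendsto.mul_const h (Or.inr hfin)) (Or.inr ENNReal.ofReal_ne_top)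
      simpa using this
    refine tendsto_of_tendsto_of_tendsto_of_le_of_le tendsto_const_nhds h0 (fun _ => zero_le)
      fun k => ?_
    refine le_trans (le_of_eq ?_) (hbd _ ((hF k).sub hf.1))
    congr 1
    ext x
    simp [inner_sub_left]

theorem inner_fderiv_apply_self {W : E3 → E3} (hW : ContDiff ℝ 1 W) (x : E3) :
    fderiv ℝ (fun y => inner ℝ (W y) y) x x =
      inner ℝ (W x) x + ∑ i, ∑ j, x i * x j * gradField W x i j := by
  have h : ∀ y, inner ℝ (W y) y = ∑ i, y i * W y i := fun y => by simp [PiLp.inner_apply]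
  simp only [h]
  have hd : HasFDerivAt (fun y => ∑ i, y i * W y i) (∑ i : Fin 3, (x i • fderiv ℝ (fun y => W y i) x
      + W x i • (EuclideanSpace.proj i : E3 →L[ℝ] ℝ))) x := by
    refine HasFDerivAt.fun_sum fun i _ => ?_
    exact (EuclideanSpace.proj i : E3 →L[ℝ] ℝ).hasFDerivAt.mul
      ((hW.component i).differentiable one_ne_zero x).hasFDerivAt
  rw [hd.fderiv]
  simp only [_root_.sum_apply, _root_.add_apply,
    _root_.smul_apply, smul_eq_mul, PiLp.proj_apply, Finset.sum_add_distrib,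
    ← sum_mul_partialD, Finset.mul_sum, gradField, Matrix.of_apply]
  rw [add_comm]
  congr 1
  · exact Finset.sum_congr rfl fun i _ => mul_comm _ _
  · exact Finset.sum_congr rfl fun i _ => Finset.sum_congr rfl fun j _ => by ring

theorem fderiv_comp_normSq {f f' : ℝ → ℝ} (hf : ∀ s, HasDerivAt f (f' s) s) (x v : E3) :
    fderiv ℝ (fun y : E3 => f (‖y‖ ^ 2)) x v = 2 * f' (‖x‖ ^ 2) * inner ℝ x v := by
  have h := ((hf _).comp_hasFDerivAt x (hasStrictFDerivAt_norm_sq x).hasFDerivAt).fderiv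
  simp only [Function.comp_def] at h
  rw [h]
  simp
  ring

theorem contDiff_one_of_hasDerivAt {f f' : ℝ → ℝ} (hf : ∀ s, HasDerivAt f (f' s) s)
    (hf' : Continuous f') : ContDiff ℝ 1 f :=
  contDiff_one_iff_deriv.2 ⟨fun s => (hf s).differentiableAt, by
    rwa [funext fun s => (hf s).deriv]⟩

/-- The first term contributes `(2 s b' + 4 b) (W·x)` with `s = |x|²`, and the second contributes
`-2 F' (W·x)`. The condition `F' = s b' + 2 b` makes these cancel, so only derivatives of `W`
remain. -/
theorem divergence_radial_combination {W : E3 → E3} (hW : ContDiff ℝ 1 W) {b b' F : ℝ → ℝ}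
    (hb : ∀ s, HasDerivAt b (b' s) s) (hF : ∀ s, HasDerivAt F (s * b' s + 2 * b s) s) (x : E3) :
    divergence (fun y => (b (‖y‖ ^ 2) * inner ℝ (W y) y) • y - F (‖y‖ ^ 2) • W y) x =
      b (‖x‖ ^ 2) * (∑ i, ∑ j, x i * x j * gradField W x i j) -
        F (‖x‖ ^ 2) * divergence W x := by
  have hWd : DifferentiableAt ℝ W x := hW.differentiable one_ne_zero x
  have hbd : DifferentiableAt ℝ (fun y : E3 => b (‖y‖ ^ 2)) x :=
    ((hb _).comp_hasFDerivAt x (hasStrictFDerivAt_norm_sq x).hasFDerivAt).differentiableAt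
  have hFd : DifferentiableAt ℝ (fun y : E3 => F (‖y‖ ^ 2)) x :=
    ((hF _).comp_hasFDerivAt x (hasStrictFDerivAt_norm_sq x).hasFDerivAt).differentiableAt
  have hid : DifferentiableAt ℝ (fun y : E3 => y) x := differentiableAt_fun_id
  have hin : DifferentiableAt ℝ (fun y => inner ℝ (W y) y) x := hWd.inner ℝ hid
  rw [divergence_sub ((hbd.fun_mul hin).fun_smul hid) (hFd.fun_smul hWd),
    divergence_smul (hbd.fun_mul hin) hid, divergence_smul hFd hWd, fderiv_fun_mul hbd hin]
  have h3 : divergence (fun y => y) x = 3 := divergence_id x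
  simp only [_root_.add_apply, _root_.smul_apply, smul_eq_mul]
  rw [h3, inner_fderiv_apply_self hW, fderiv_comp_normSq hb, fderiv_comp_normSq hF,
    real_inner_self_eq_norm_sq, real_inner_comm x (W x)]
  ring

/-- The integral of the radial derivative of the normal component of a smooth field, in terms of
its divergence and its flux through the outer sphere. -/
theorem setIntegral_shell_radial {R₁ R₂ : ℝ} (hR₂ : 0 < R₂) {W : E3 → E3}
    (hW : ContDiff ℝ 1 W) {b b' F : ℝ → ℝ} (hb' : Continuous b')
    (hb : ∀ s, HasDerivAt b (b' s) s) (hF : ∀ s, HasDerivAt F (s * b' s + 2 * b s) s)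
    (hb0 : ∀ s, s ≤ R₁ ^ 2 → b s = 0) (hF0 : ∀ s, s ≤ R₁ ^ 2 → F s = 0) (hbR : b (R₂ ^ 2) = 0) :
    ∫ x in shell R₁ R₂, b (‖x‖ ^ 2) * (∑ i, ∑ j, x i * x j * gradField W x i j) =
      (∫ x in shell R₁ R₂, F (‖x‖ ^ 2) * divergence W x) -
        F (R₂ ^ 2) * ∫ x, inner ℝ (W x) (R₂⁻¹ • x) ∂(sphereMeasure R₂) := by
  have hbc := contDiff_one_of_hasDerivAt hb hb'
  have hFc : ContDiff ℝ 1 F := contDiff_one_of_hasDerivAt hF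
    ((continuous_id.mul hb').add (hbc.continuous.const_mul 2))
  have hs : ContDiff ℝ 1 fun x : E3 => ‖x‖ ^ 2 := contDiff_norm_sq ℝ
  have hbs : ContDiff ℝ 1 fun x : E3 => b (‖x‖ ^ 2) := hbc.comp hs
  have hFs : ContDiff ℝ 1 fun x : E3 => F (‖x‖ ^ 2) := hFc.comp hs
  have hin : ContDiff ℝ 1 fun x : E3 => inner ℝ (W x) x := hW.inner ℝ contDiff_id
  have hX : ContDiff ℝ 1 fun y => (b (‖y‖ ^ 2) * inner ℝ (W y) y) • y - F (‖y‖ ^ 2) • W y := by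
    fun_prop
  have hball := integral_ball_divergence hX hR₂
  simp only [divergence_radial_combination hW hb hF] at hball
  have hsub : shell R₁ R₂ ⊆ Metric.ball 0 R₂ := fun x hx => mem_ball_zero_iff.2 hx.2
  rw [setIntegral_eq_of_subset_of_forall_sdiff_eq_zero measurableSet_ball hsub] at hball
  · have hgrad : ∀ i j, Continuous fun x => gradField W x i j := fun i j =>
      continuous_partialD (hW.component i) j
    have hcont : ∀ {g : E3 → ℝ}, Continuous g → IntegrableOn g (shell R₁ R₂) := fun hg =>
      (hg.continuousOn.integrableOn_compact (isCompact_closedBall 0 R₂)).mono_set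
        (hsub.trans Metric.ball_subset_closedBall)
    have i1 : IntegrableOn (fun x => b (‖x‖ ^ 2) * ∑ i, ∑ j, x i * x j * gradField W x i j)
        (shell R₁ R₂) := by
      refine hcont (hbs.continuous.mul (continuous_finsetSum _ fun i _ => continuous_finsetSum _
        fun j _ => ?_))
      have := hgrad i j
      fun_prop
    have i2 : IntegrableOn (fun x => F (‖x‖ ^ 2) * divergence W x) (shell R₁ R₂) :=
      hcont (hFs.continuous.mul (continuous_divergence hW))
    rw [integral_sub i1 i2] at hball
    -- On the outer sphere `b` vanishes, so only `-F W` contributes to the flux.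
    have : ∫ x, inner ℝ ((b (‖x‖ ^ 2) * inner ℝ (W x) x) • x - F (‖x‖ ^ 2) • W x) (R₂⁻¹ • x)
        ∂(sphereMeasure R₂) = -(F (R₂ ^ 2) * ∫ x, inner ℝ (W x) (R₂⁻¹ • x)
          ∂(sphereMeasure R₂)) := by
      rw [← integral_const_mul, ← integral_neg]
      refine integral_congr_ae ((ae_norm_eq_sphereMeasure hR₂.le).mono fun x hx => ?_)
      simp only [hx, hbR, zero_mul, zero_smul, zero_sub, inner_neg_left, inner_smul_left]
      simp
    rw [this] at hball
    linarith
  -- Inside the inner sphere `b` and `F` both vanish, so the field there may be arbitrary and there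
  -- is no flux term at `R₁`.
  · intro x hx
    have hx1 : ‖x‖ ≤ R₁ := by
      by_contra! h
      exact hx.2 ⟨h, mem_ball_zero_iff.1 hx.1⟩
    have : ‖x‖ ^ 2 ≤ R₁ ^ 2 := by gcongr
    rw [hb0 _ this, hF0 _ this]
    ring

theorem shell_subset_closedBall (R₁ R₂ : ℝ) : shell R₁ R₂ ⊆ Metric.closedBall 0 R₂ :=
  fun _ hx => mem_closedBall_zero_iff.2 hx.2.le

instance isFiniteMeasure_restrict_shell (R₁ R₂ : ℝ) :
    IsFiniteMeasure ((volume : Measure E3).restrict (shell R₁ R₂)) :=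
  isFiniteMeasure_restrict.2 ((measure_mono (shell_subset_closedBall R₁ R₂)).trans_lt
    measure_closedBall_lt_top).ne

theorem measurableSet_shell (R₁ R₂ : ℝ) : MeasurableSet (shell R₁ R₂) :=
  (measurableSet_lt measurable_const measurable_norm).inter
    (measurableSet_lt measurable_norm measurable_const)

theorem exists_bound_on_shell (R₁ R₂ : ℝ) {c : E3 → ℝ} (hc : Continuous c) :
    ∃ M, ∀ᵐ x ∂((volume : Measure E3).restrict (shell R₁ R₂)), ‖c x‖ ≤ M := by
  obtain ⟨M, hM⟩ := (isCompact_closedBall (0 : E3) R₂).exists_bound_of_continuousOn hc.continuousOn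
  exact ⟨M, (ae_restrict_iff' (measurableSet_shell R₁ R₂)).2
    (Eventually.of_forall fun x hx => hM x (shell_subset_closedBall R₁ R₂ hx))⟩

theorem integrable_mul_on_shell {R₁ R₂ : ℝ} {c g : E3 → ℝ} (hc : Continuous c)
    (hg : MemLp g 2 (volume.restrict (shell R₁ R₂))) :
    Integrable (fun x => c x * g x) (volume.restrict (shell R₁ R₂)) := by
  obtain ⟨M, hM⟩ := exists_bound_on_shell R₁ R₂ hc
  have hc2 : MemLp c 2 (volume.restrict (shell R₁ R₂)) :=
    MemLp.of_bound hc.aestronglyMeasurable M hM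
  exact hc2.integrable_mul hg

theorem integrable_sum_mul_on_shell {R₁ R₂ : ℝ} {G : E3 → Matrix (Fin 3) (Fin 3) ℝ}
    (hG : ∀ i j, MemLp (fun x => G x i j) 2 (volume.restrict (shell R₁ R₂)))
    {c : Fin 3 → Fin 3 → E3 → ℝ} (hc : ∀ i j, Continuous (c i j)) :
    Integrable (fun x => ∑ i, ∑ j, c i j x * G x i j) (volume.restrict (shell R₁ R₂)) :=
  integrable_finsetSum _ fun i _ => integrable_finsetSum _ fun j _ =>
    integrable_mul_on_shell (hc i j) (hG i j)

theorem tendsto_integral_sum_mul_on_shell {R₁ R₂ : ℝ} {V : E3 → E3}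
    {G : E3 → Matrix (Fin 3) (Fin 3) ℝ} {W : ℕ → E3 → E3}
    (hG : ∀ i j, MemLp (fun x => G x i j) 2 (volume.restrict (shell R₁ R₂)))
    (hW : ∀ k, ContDiff ℝ 1 (W k)) (hlim : TendstoW12 (shell R₁ R₂) W V G)
    {c : Fin 3 → Fin 3 → E3 → ℝ} (hc : ∀ i j, Continuous (c i j)) :
    Tendsto (fun k => ∫ x in shell R₁ R₂, ∑ i, ∑ j, c i j x * gradField (W k) x i j) atTop
      (𝓝 (∫ x in shell R₁ R₂, ∑ i, ∑ j, c i j x * G x i j)) := by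
  have hcont : ∀ k i j, Continuous fun x => gradField (W k) x i j := fun k i j =>
    continuous_partialD ((hW k).component i) j
  have hWm : ∀ k i j, MemLp (fun x => gradField (W k) x i j) 2
      (volume.restrict (shell R₁ R₂)) := fun k i j => by
    obtain ⟨M, hM⟩ := exists_bound_on_shell R₁ R₂ (hcont k i j)
    exact MemLp.of_bound (hcont k i j).aestronglyMeasurable M hM
  have hsplit : ∀ {H : E3 → Matrix (Fin 3) (Fin 3) ℝ},
      (∀ i j, MemLp (fun x => H x i j) 2 (volume.restrict (shell R₁ R₂))) →
      ∫ x in shell R₁ R₂, ∑ i, ∑ j, c i j x * H x i j =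
        ∑ i, ∑ j, ∫ x in shell R₁ R₂, c i j x * H x i j := fun hH => by
    rw [integral_finsetSum _ fun i _ => integrable_finsetSum _ fun j _ =>
      integrable_mul_on_shell (hc i j) (hH i j)]
    exact Finset.sum_congr rfl fun i _ => integral_finsetSum _ fun j _ =>
      integrable_mul_on_shell (hc i j) (hH i j)
  simp only [hsplit (hWm _), hsplit hG]
  refine tendsto_finsetSum _ fun i _ => tendsto_finsetSum _ fun j _ => ?_
  obtain ⟨M, hM⟩ := exists_bound_on_shell R₁ R₂ (hc i j)
  exact tendsto_integral_inner_of_tendsto_eLpNorm (E := ℝ) (hG i j)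
    (fun k => (hcont k i j).aestronglyMeasurable) (hc i j).aestronglyMeasurable hM (hlim.2 i j)

/-- `setIntegral_shell_radial` for solenoidal fields in `W^{1,2}` with a trace in `L²`. -/
theorem setIntegral_shell_radial_of_hasTrace {R₁ R₂ : ℝ} (hR₂ : 0 < R₂) {V v : E3 → E3}
    {G : E3 → Matrix (Fin 3) (Fin 3) ℝ} (hV : IsW12 (shell R₁ R₂) V G)
    (hsol : IsSolenoidal (shell R₁ R₂) G) (hv : MemLp v 2 (shellBoundaryMeasure R₁ R₂))
    (htr : HasTrace (shell R₁ R₂) (shellBoundaryMeasure R₁ R₂) V G v)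
    {b b' F : ℝ → ℝ} (hb' : Continuous b')
    (hb : ∀ s, HasDerivAt b (b' s) s) (hF : ∀ s, HasDerivAt F (s * b' s + 2 * b s) s)
    (hb0 : ∀ s, s ≤ R₁ ^ 2 → b s = 0) (hF0 : ∀ s, s ≤ R₁ ^ 2 → F s = 0) (hbR : b (R₂ ^ 2) = 0) :
    ∫ x in shell R₁ R₂, b (‖x‖ ^ 2) * (∑ i, ∑ j, x i * x j * G x i j) =
      -(F (R₂ ^ 2) * ∫ x, inner ℝ (v x) (R₂⁻¹ • x) ∂(sphereMeasure R₂)) := by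
  obtain ⟨W, hW, hlim, hbdry⟩ := htr
  have hW1 : ∀ k, ContDiff ℝ 1 (W k) := fun k => (hW k).of_le (by simp)
  have hbc : Continuous b := (contDiff_one_of_hasDerivAt hb hb').continuous
  have hFc : Continuous F := continuous_iff_continuousAt.2 fun s => (hF s).continuousAt
  have eq1 : ∀ (H : E3 → Matrix (Fin 3) (Fin 3) ℝ) (x : E3),
      b (‖x‖ ^ 2) * (∑ i, ∑ j, x i * x j * H x i j) =
        ∑ i, ∑ j, (b (‖x‖ ^ 2) * (x i * x j)) * H x i j := fun H x => by
    simp only [Finset.mul_sum, mul_assoc]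
  have eq2 : ∀ (H : E3 → Matrix (Fin 3) (Fin 3) ℝ) (x : E3), F (‖x‖ ^ 2) * (H x).trace =
      ∑ i, ∑ j, (F (‖x‖ ^ 2) * if i = j then 1 else 0) * H x i j := fun H x => by
    simp [Matrix.trace, Finset.mul_sum]
  have lim1 := tendsto_integral_sum_mul_on_shell hV.memLp_grad hW1 hlim
    (c := fun i j x => b (‖x‖ ^ 2) * (x i * x j)) fun i j => by fun_prop
  have lim2 := tendsto_integral_sum_mul_on_shell hV.memLp_grad hW1 hlim
    (c := fun i j x => F (‖x‖ ^ 2) * if i = j then 1 else 0) fun i j => by fun_prop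
  simp only [← eq1, ← eq2, trace_gradField] at lim1 lim2
  have hle : sphereMeasure R₂ ≤ shellBoundaryMeasure R₁ R₂ := Measure.le_add_left le_rfl
  have lim3 := tendsto_integral_inner_of_tendsto_eLpNorm (μ := sphereMeasure R₂) (M := 1)
    (c := fun x => R₂⁻¹ • x) (hv.mono_measure hle)
    (fun k => (hW k).continuous.aestronglyMeasurable) (by fun_prop)
    ((ae_norm_eq_sphereMeasure hR₂.le).mono fun x hx => by
      rw [norm_smul, hx, Real.norm_of_nonneg (by positivity), inv_mul_cancel₀ hR₂.ne'])
    (tendsto_of_tendsto_of_tendsto_of_le_of_le tendsto_const_nhds hbdry (fun _ => zero_le)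
      fun k => eLpNorm_mono_measure _ hle)
  have hzero : ∫ x in shell R₁ R₂, F (‖x‖ ^ 2) * (G x).trace = 0 := by
    refine integral_eq_zero_of_ae ?_
    filter_upwards [hsol] with x hx
    simp [hx]
  rw [hzero] at lim2
  have lim4 := lim2.sub (lim3.const_mul (F (R₂ ^ 2)))
  simp only [← setIntegral_shell_radial hR₂ (hW1 _) hb' hb hF hb0 hF0 hbR, zero_sub] at lim4
  exact tendsto_nhds_unique lim1 lim4

/-! ### Summation of the convection forms -/

theorem convectionForm_eq {Ω : Set E3} {u : E3 → E3} {G : E3 → Matrix (Fin 3) (Fin 3) ℝ} :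
    convectionForm Ω u G = ∫ x in Ω, ∑ i, ∑ j, (u x i * u x j) * G x i j := by
  simp only [convectionForm]
  congr 1
  ext x
  exact Finset.sum_congr rfl fun i _ => Finset.sum_congr rfl fun j _ => by ring

/-- The convection forms of the test fields add up to an integral that involves only the radial
derivative of the radial component. -/
theorem sum_convectionForm_testField {R₁ R₂ : ℝ} {G : E3 → Matrix (Fin 3) (Fin 3) ℝ}
    (hG : ∀ i j, MemLp (fun x => G x i j) 2 (volume.restrict (shell R₁ R₂)))
    (hsol : IsSolenoidal (shell R₁ R₂) G) {η : ℝ → ℝ} (hη : ContDiff ℝ ∞ η) (N : ℝ) :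
    ∑ k, axisWeight k *
      (convectionForm (shell R₁ R₂) (testField η (fun t => Real.cos (N * t)) (axis k)) G +
        convectionForm (shell R₁ R₂) (testField η (fun t => Real.sin (N * t)) (axis k)) G) =
    ∫ x in shell R₁ R₂, radialWeight η N (‖x‖ ^ 2) * ∑ i, ∑ j, x i * x j * G x i j := by
  have hcos : ContDiff ℝ ∞ fun t => Real.cos (N * t) := by fun_prop
  have hsin : ContDiff ℝ ∞ fun t => Real.sin (N * t) := by fun_prop
  have hint : ∀ {C : ℝ → ℝ}, ContDiff ℝ ∞ C → ∀ a, Integrable (fun x => ∑ i, ∑ j,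
      (testField η C a x i * testField η C a x j) * G x i j)
      (volume.restrict (shell R₁ R₂)) := fun hC a =>
    integrable_sum_mul_on_shell hG fun i j => by
      have := (contDiff_testField hη hC a).continuous
      fun_prop
  simp only [convectionForm_eq]
  simp only [← integral_add (hint hcos _) (hint hsin _), ← integral_const_mul]
  rw [← integral_finsetSum]
  swap
  · exact fun k _ => ((hint hcos _).add (hint hsin _)).const_mul _
  refine integral_congr_ae ?_
  filter_upwards [hsol] with x hx
  have h1 : ∀ i j, _ := sum_testField_mul_testField η N x
  calc _ = ∑ i, ∑ j, (∑ k, axisWeight k *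
      (testField η (fun t => Real.cos (N * t)) (axis k) x i *
          testField η (fun t => Real.cos (N * t)) (axis k) x j +
        testField η (fun t => Real.sin (N * t)) (axis k) x i *
          testField η (fun t => Real.sin (N * t)) (axis k) x j)) * G x i j := by
        simp only [← Finset.sum_add_distrib, Finset.mul_sum, Finset.sum_mul]
        rw [Finset.sum_comm]
        refine Finset.sum_congr rfl fun i _ => ?_
        rw [Finset.sum_comm]
        exact Finset.sum_congr rfl fun j _ => Finset.sum_congr rfl fun k _ => by ring
    _ = _ := by
        simp only [h1, add_mul, Finset.sum_add_distrib]
        -- The isotropic part of the tensor sees only the trace of `G`, which is the divergence.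
        have h2 : ∀ A : ℝ, ∑ i, ∑ j, A * (if i = j then 1 else 0) * G x i j = A * (G x).trace :=
          fun A => by simp [Matrix.trace, Finset.mul_sum]
        simp only [h2, hx, mul_zero, zero_add]
        simp only [Finset.mul_sum, mul_assoc]

/-! ### Choice of the profile and of the frequency -/

theorem contDiff_radialWeight {η : ℝ → ℝ} (hη : ContDiff ℝ ∞ η) (N : ℝ) :
    ContDiff ℝ ∞ (radialWeight η N) := by
  have := hη.deriv_infty
  unfold radialWeight
  fun_prop

theorem radialWeight_eq_zero {η : ℝ → ℝ} (N : ℝ) {s : ℝ} (h : s ∉ tsupport η) :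
    radialWeight η N s = 0 := by
  have h0 : η s = 0 := image_eq_zero_of_notMem_tsupport h
  have h1 : deriv η s = 0 := by
    by_contra h'
    exact h (support_deriv_subset h')
  simp [radialWeight, h0, h1]

/-- The integral is `28 N² ∫ η²` minus a quantity independent of `N`, and `∫ η² > 0`. -/
theorem exists_integral_radialWeight_pos {η : ℝ → ℝ} (hη : ContDiff ℝ ∞ η) {r s : ℝ} (hr : 0 < r)
    (hs : s ∈ Set.Icc 0 r) (hηs : η s ≠ 0) : ∃ N : ℝ, 0 < ∫ t in (0 : ℝ)..r, radialWeight η N t := by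
  have hη' := hη.deriv_infty.continuous
  have hηc := hη.continuous
  have hI : 0 < ∫ t in (0 : ℝ)..r, η t ^ 2 :=
    intervalIntegral.integral_pos hr (by fun_prop) (fun _ _ => sq_nonneg _)
      ⟨s, hs, by positivity⟩
  set I := ∫ t in (0 : ℝ)..r, η t ^ 2
  set J := ∫ t in (0 : ℝ)..r, 48 * deriv η t * (t * deriv η t + 2 * η t) with hJ
  -- This value solves `28 N² I = |J| + 1`, which exceeds `J`.
  refine ⟨√((|J| + 1) / (28 * I)), ?_⟩
  simp only [radialWeight]
  rw [intervalIntegral.integral_sub (Continuous.intervalIntegrable (by fun_prop) _ _)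
    (Continuous.intervalIntegrable (by fun_prop) _ _), intervalIntegral.integral_const_mul,
    Real.sq_sqrt (by positivity), ← hJ]
  have : 28 * ((|J| + 1) / (28 * I)) * I = |J| + 1 := by field_simp
  have h2 := le_abs_self J
  change 0 < 28 * ((|J| + 1) / (28 * I)) * I - J
  linarith

theorem exists_bump {p q : ℝ} (hpq : p < q) :
    ∃ η : ℝ → ℝ, ContDiff ℝ ∞ η ∧ HasCompactSupport η ∧ tsupport η ⊆ Set.Ioo p q ∧
      η ((p + q) / 2) ≠ 0 := by
  let f : ContDiffBump ((p + q) / 2) := ⟨(q - p) / 8, (q - p) / 4, by linarith, by linarith⟩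
  refine ⟨f, f.contDiff, f.hasCompactSupport, ?_, ?_⟩
  · rw [f.tsupport_eq, Real.closedBall_eq_Icc]
    intro x hx
    have h1 : (p + q) / 2 - (q - p) / 4 ≤ x := hx.1
    have h2 : x ≤ (p + q) / 2 + (q - p) / 4 := hx.2
    constructor <;> linarith
  · rw [f.one_of_mem_closedBall (Metric.mem_closedBall_self f.rIn_pos.le)]
    exact one_ne_zero

/-! ### The contradiction -/

theorem mainTheorem2 (R₁ R₂ : ℝ) (hR₁ : 0 < R₁) (hR₂ : R₁ < R₂)
    (v : E3 → E3) (hv : MemLp v 2 (shellBoundaryMeasure R₁ R₂))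
    (Φ : ℝ)
    (hΦ₂ : ∫ x, inner ℝ (v x) (R₂⁻¹ • x) ∂(sphereMeasure R₂) = Φ)
    (hΦ₁ : ∫ x, inner ℝ (v x) (-(R₁⁻¹ • x)) ∂(sphereMeasure R₁) = -Φ)
    (hΦ : 0 < Φ) :
    ¬ LerayHopfEC (shell R₁ R₂) (shellBoundaryMeasure R₁ R₂) v := by
  intro hEC
  have hR₂0 : 0 < R₂ := hR₁.trans hR₂
  have hsq : R₁ ^ 2 < R₂ ^ 2 := by gcongr
  obtain ⟨η, hη, hηc, hηs, hη0⟩ := exists_bump hsq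
  obtain ⟨N, hN⟩ := exists_integral_radialWeight_pos hη (r := R₂ ^ 2) (by positivity)
    ⟨by positivity, by linarith⟩ hη0
  have hbC := contDiff_radialWeight hη N
  have hb : ∀ s, HasDerivAt (radialWeight η N) (deriv (radialWeight η N) s) s := fun s =>
    (hbC.differentiable (by simp) s).hasDerivAt
  have hb0 : ∀ s, s ≤ R₁ ^ 2 → radialWeight η N s = 0 := fun s hs =>
    radialWeight_eq_zero N fun h => (hηs h).1.not_ge hs
  have hbR : radialWeight η N (R₂ ^ 2) = 0 := radialWeight_eq_zero N fun h => (hηs h).2.false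
  -- The primitive of `s b' + 2 b` that vanishes up to `R₁ ^ 2` is `s b + ∫₀ˢ b`.
  have hF : ∀ s, HasDerivAt (fun s => s * radialWeight η N s + ∫ t in (0 : ℝ)..s,
      radialWeight η N t) (s * deriv (radialWeight η N) s + 2 * radialWeight η N s) s := fun s => by
    have h := ((hasDerivAt_id s).mul (hb s)).add (intervalIntegral.integral_hasDerivAt_right
      (hbC.continuous.intervalIntegrable 0 s) (hbC.continuous.stronglyMeasurableAtFilter _ _)
      hbC.continuous.continuousAt)
    convert! h using 1
    simp only [id]
    ring
  have hF0 : ∀ s, s ≤ R₁ ^ 2 → s * radialWeight η N s +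
      ∫ t in (0 : ℝ)..s, radialWeight η N t = 0 := fun s hs => by
    rw [hb0 s hs, mul_zero, zero_add]
    refine intervalIntegral.integral_zero_ae (Eventually.of_forall fun t ht => hb0 t ?_)
    exact ht.2.trans (max_le (sq_nonneg _) hs)
  set J := ∫ t in (0 : ℝ)..R₂ ^ 2, radialWeight η N t
  set uc := fun k => testField η (fun t => Real.cos (N * t)) (axis k)
  set us := fun k => testField η (fun t => Real.sin (N * t)) (axis k)
  have htest : ∀ {C : ℝ → ℝ}, ContDiff ℝ ∞ C → ∀ a,
      IsW120 (shell R₁ R₂) (testField η C a) (gradField (testField η C a)) ∧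
      IsSolenoidal (shell R₁ R₂) (gradField (testField η C a)) := fun {C} hC a => by
    refine ⟨isW120_of_contDiff (contDiff_testField hη hC a) (hasCompactSupport_testField hηc C a)
      fun x hx => ?_, Eventually.of_forall fun x => ?_⟩
    · have h := hηs (tsupport_testField_subset η C a hx)
      exact ⟨lt_of_pow_lt_pow_left₀ 2 (norm_nonneg x) h.1, lt_of_pow_lt_pow_left₀ 2 hR₂0.le h.2⟩
    · rw [trace_gradField, divergence_testField hη hC]
  -- `K` is built from the test fields alone, so it stays fixed while `ε` and the extension `V`
  -- vary.
  set K := ∑ k, axisWeight k * (gradNormSq (shell R₁ R₂) (gradField (uc k)) +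
    gradNormSq (shell R₁ R₂) (gradField (us k))) with hK
  have key : ∀ ε : ℝ, 0 < ε → J * Φ ≤ ε * K := by
    intro ε hε
    obtain ⟨V, G, hV, hsol, htr, hineq⟩ := hEC ε hε
    have h1 := setIntegral_shell_radial_of_hasTrace hR₂0 hV hsol hv htr
      hbC.deriv_infty.continuous hb hF hb0 hF0 hbR
    -- At `R₂ ^ 2` the weight vanishes and `F` equals `J`, so the weighted convection forms add up
    -- to `-(J * Φ)`.
    rw [← sum_convectionForm_testField hV.memLp_grad hsol hη N, hΦ₂, hbR, mul_zero, zero_add] at h1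
    rw [eq_comm, neg_eq_iff_eq_neg] at h1
    rw [h1, hK, Finset.mul_sum, ← Finset.sum_neg_distrib]
    refine Finset.sum_le_sum fun k _ => ?_
    have hc := htest (C := fun t => Real.cos (N * t)) (by fun_prop) (axis k)
    have hs := htest (C := fun t => Real.sin (N * t)) (by fun_prop) (axis k)
    have := mul_le_mul_of_nonneg_left (add_le_add (hineq _ _ hc.1 hc.2) (hineq _ _ hs.1 hs.2))
      (axisWeight_nonneg k)
    linarith
  have hpos : 0 < J * Φ := mul_pos hN hΦ
  -- With this `ε`, the right side `ε K` is at most `J * Φ / 2`; the denominator uses `|K| + 1` to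
  -- be positive without knowing the sign of `K`.
  have h := key (J * Φ / (2 * (|K| + 1))) (by positivity)
  have h2 : J * Φ / (2 * (|K| + 1)) * K ≤ J * Φ / (2 * (|K| + 1)) * (|K| + 1) := by
    gcongr
    linarith [le_abs_self K]
  have h3 : J * Φ / (2 * (|K| + 1)) * (|K| + 1) = J * Φ / 2 := by field_simp
  linarith
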